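/- A signed graph $\Sigma=(G,\sigma)$ is a finite simple graph $G$ with a sign function $\sigma:E(G)\to\{-1,1\}$. A coloring $c:V(G)\to\mathbb Z$ is proper if $c(u)\neq\sigma(e)c(v)$ for each edge $e=uv$. For a positive integer $k$, let $M_k=\{\pm1,\dots,\pm t\}$ if $k=2t$ and $M_k=\{0,\pm1,\dots,\pm t\}$ if $k=2t+1$, and let $P(\Sigma,k)$ be the number of proper colorings with values in $M_k$. A $k$-assignment $L$ assigns to each vertex $v$ a set $L(v)\subset\mathbb Z$ with $|L(v)|=k$; $P(\Sigma,L)$ is the number of proper colorings $c$ with $c(v)\in L(v)$ for all $v$, and $P_l(\Sigma,k)$ is the minimum of $P(\Sigma,L)$ over all $k$-assignments $L$. A connected component is unbalanced if it contains a cycle with an odd number of negative edges. Theorem. Let $\Sigma$ be a signed graph with $m$ edges and let $k$ be a positive integer with $k>\binom m3+\binom m4+m-1$. Then $$P_l(\Sigma,k)=P(\Sigma,k).$$ Further, every $k$-assignment $L$ with $P(\Sigma,L)=P(\Sigma,k)$ satisfies $L(u)=\sigma(e)L(v)=\{\sigma(e)a:a\in L(v)\}$ for each edge $e=uv$, and $L(v)=-L(v)=\{-a:a\in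 L(v)\}$ for each vertex $v$ in any unbalanced component of $\Sigma$. -/

import Mathlib

/-- A signed graph on the vertex set `V`: a simple graph together with a sign
in `{1, -1}` (the units of `ℤ`) for each of its edges. -/
structure SignedGraph (V : Type*) where
  /-- the underlying graph -/
  graph : SimpleGraph V
  /-- the sign function, defined on the edges only -/
  sign : graph.edgeSet → ℤˣ

namespace SignedGraph

variable {V : Type*}

/-- The sign of the edge `uv`, as an integer. -/
def edgeSign (S : SignedGraph V) {u v : V} (h : S.graph.Adj u v) : ℤ :=
  ((S.sign ⟨s(u, v), h⟩ : ℤˣ) : ℤ)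

/-- The number of edges. -/
noncomputable def numEdges (S : SignedGraph V) : ℕ := S.graph.edgeSet.ncard

/-- `e` is a negative edge. -/
def IsNegative (S : SignedGraph V) (e : Sym2 V) : Prop :=
  ∃ h : e ∈ S.graph.edgeSet, S.sign ⟨e, h⟩ = -1

/-- A closed walk is an unbalanced cycle if it is a cycle and the number of its negative edges
is odd. -/
def IsUnbalancedCycle (S : SignedGraph V) {u : V} (p : S.graph.Walk u u) : Prop :=
  p.IsCycle ∧ Odd {e : Sym2 V | e ∈ p.edges ∧ S.IsNegative e}.ncard

/-- A connected component is unbalanced if it contains an unbalanced cycle. -/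
def IsUnbalancedComponent (S : SignedGraph V) (C : S.graph.ConnectedComponent) : Prop :=
  ∃ (u : V) (p : S.graph.Walk u u), u ∈ C.supp ∧ S.IsUnbalancedCycle p

/-- A vertex coloring by integers is proper if `c u ≠ σ(e) c v` for every edge `e = uv`. -/
def IsProper (S : SignedGraph V) (c : V → ℤ) : Prop :=
  ∀ (u v : V) (h : S.graph.Adj u v), c u ≠ S.edgeSign h * c v

/-- The color set `M_k`: it is `{±1, …, ±t}` if `k = 2t` and `{0, ±1, …, ±t}` if `k = 2t+1`. -/
noncomputable def colorSet (k : ℕ) : Finset ℤ :=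
  (Finset.Icc (-((k / 2 : ℕ) : ℤ)) ((k / 2 : ℕ) : ℤ)).filter (fun a => a ≠ 0 ∨ Odd k)

theorem card_colorSet (k : ℕ) : (colorSet k).card = k := by
  rcases Nat.even_or_odd k with hk | hk
  · have h : colorSet k = (Finset.Icc (-((k / 2 : ℕ) : ℤ)) ((k / 2 : ℕ) : ℤ)).erase 0 := by
      ext a
      have : ¬ Odd k := Nat.not_odd_iff_even.mpr hk
      simp [colorSet, this]
      tauto
    obtain ⟨t, rfl⟩ := hk
    rw [h, Finset.card_erase_of_mem (by simp; omega), Int.card_Icc]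
    omega
  · have h : colorSet k = Finset.Icc (-((k / 2 : ℕ) : ℤ)) ((k / 2 : ℕ) : ℤ) := by
      ext a
      simp [colorSet, hk]
    obtain ⟨t, rfl⟩ := hk
    rw [h, Int.card_Icc]
    omega

/-- `P(Σ, k)`: the number of proper colorings with all colors in `M_k`. -/
noncomputable def chromaticFunction (S : SignedGraph V) (k : ℕ) : ℕ :=
  {c : V → ℤ | S.IsProper c ∧ ∀ v, c v ∈ colorSet k}.ncard

/-- `P(Σ, L)`: the number of proper colorings `c` with `c v ∈ L v` for every vertex `v`. -/
noncomputable def numListColorings (S : SignedGraph V) (L : V → Finset ℤ) : ℕ :=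
  {c : V → ℤ | S.IsProper c ∧ ∀ v, c v ∈ L v}.ncard

/-- A `k`-assignment: every vertex gets a list of exactly `k` integers. -/
def IsKAssignment (k : ℕ) (L : V → Finset ℤ) : Prop :=
  ∀ v, (L v).card = k

/-- The list-coloring function `P_l(Σ, k)`: the minimum of `P(Σ, L)` over all
`k`-assignments `L`. -/
noncomputable def listColoringFunction (S : SignedGraph V) (k : ℕ) : ℕ :=
  sInf {N : ℕ | ∃ L : V → Finset ℤ, IsKAssignment k L ∧ S.numListColorings L = N}

/-- The infimum in the definition of `listColoringFunction` is a minimum. -/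
theorem isLeast_listColoringFunction (S : SignedGraph V) (k : ℕ) :
    IsLeast {N : ℕ | ∃ L : V → Finset ℤ, IsKAssignment k L ∧ S.numListColorings L = N}
      (S.listColoringFunction k) :=
  ⟨Nat.sInf_mem ⟨_, fun _ => colorSet k, fun _ => card_colorSet k, rfl⟩,
    fun _ hN => Nat.sInf_le hN⟩

end SignedGraph

/-! For each edge consider the event that a coloring is in conflict there, so that a proper coloring
avoids all events. Write `n` for the number of vertices and `m` for the number of edges.
Bonferroni's inequalities bound `P(Σ, L)` below by the terms up to triples of edges, and `P(Σ, k)`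
above by the terms up to quadruples (`le_numListColorings`, `numListColorings_le`).

If the lists disagree along some edge, compare term by term, after multiplying by `k ^ 3`. Let `δ e
≥ 0` be `k ^ 2` times the number of conflicts at `e` that `L` lacks relative to `M_k`. The single
edges gain `k * ∑ δ`, and the pairs lose at most `(m - 1) * ∑ δ`, since the deficit of a pair is
controlled by those of its two edges (`le_mul_conflictCount_pair`). Each triple and each quadruple
costs at most `k ^ n`. A disagreement forces `∑ δ ≥ k ^ n`, so the bound on `k` makes `P(Σ, L)`
strictly larger (`chromaticFunction_lt_numListColorings`).

If the lists agree along all edges, embeddings of `M_k` into the lists that respect the signs turn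
`M_k`-colorings injectively into `L`-colorings (`ListsAgree.chromaticFunction_le`). Hence `M_k`
attains the minimum and every minimizer agrees along edges; going around an unbalanced cycle then
makes the lists symmetric. -/

namespace SignedGraph

/-! ### Edge conflicts -/

section Counting

open Finset Function
open scoped Classical

variable {V : Type*}

/-- The sign of a pair of vertices, with the value `1` on nonedges. -/
noncomputable def totalSign (S : SignedGraph V) (e : Sym2 V) : ℤˣ :=
  if h : e ∈ S.graph.edgeSet then S.sign ⟨e, h⟩ else 1

theorem edgeSign_eq_totalSign (S : SignedGraph V) {u v : V} (h : S.graph.Adj u v) :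
    S.edgeSign h = S.totalSign s(u, v) := by
  have h' : s(u, v) ∈ S.graph.edgeSet := h
  simp [edgeSign, totalSign, h']

/-- The coloring `c` violates the properness condition at the edge `e`. -/
def Conflict (S : SignedGraph V) (c : V → ℤ) (e : Sym2 V) : Prop :=
  ∀ u v, e = s(u, v) → c u = S.totalSign e * c v

theorem unit_mul_unit_mul (s : ℤˣ) (a : ℤ) : (s : ℤ) * (s * a) = a := by
  rcases Int.units_eq_one_or s with rfl | rfl <;> simp

theorem eq_unit_mul_comm {s : ℤˣ} {a b : ℤ} : a = s * b ↔ b = s * a :=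
  ⟨fun h => by rw [h, unit_mul_unit_mul], fun h => by rw [h, unit_mul_unit_mul]⟩

/-- A sign is its own inverse, so the condition does not depend on the orientation of the edge. -/
theorem conflict_mk (S : SignedGraph V) (c : V → ℤ) (u v : V) :
    S.Conflict c s(u, v) ↔ c u = S.totalSign s(u, v) * c v := by
  refine ⟨fun h => h u v rfl, fun h x y hxy => ?_⟩
  rcases Sym2.eq_iff.1 hxy with ⟨rfl, rfl⟩ | ⟨rfl, rfl⟩
  · exact h
  · exact eq_unit_mul_comm.1 h

theorem conflict_update (S : SignedGraph V) {x : V} {e : Sym2 V} (hx : x ∉ e) (c : V → ℤ) (a : ℤ) :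
    S.Conflict (update c x a) e ↔ S.Conflict c e := by
  induction e using Sym2.ind with
  | _ u v =>
    rw [Sym2.mem_iff, not_or] at hx
    rw [conflict_mk, conflict_mk, update_of_ne (Ne.symm hx.1), update_of_ne (Ne.symm hx.2)]

theorem isProper_iff (S : SignedGraph V) (c : V → ℤ) :
    S.IsProper c ↔ ∀ e ∈ S.graph.edgeSet, ¬ S.Conflict c e := by
  constructor
  · intro h e he
    induction e using Sym2.ind with
    | _ u v =>
      rw [conflict_mk, ← edgeSign_eq_totalSign S he]
      exact h u v he
  · intro h u v huv
    have := h s(u, v) huv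
    rwa [conflict_mk, ← edgeSign_eq_totalSign S huv] at this

theorem unit_mul_mem_colorSet {k : ℕ} {a : ℤ} (s : ℤˣ) (ha : a ∈ colorSet k) :
    s * a ∈ colorSet k := by
  rcases Int.units_eq_one_or s with rfl | rfl
  · simpa using ha
  · simp only [colorSet, mem_filter, mem_Icc] at ha ⊢
    simp
    refine ⟨by omega, by tauto⟩

theorem isKAssignment_colorSet (k : ℕ) : IsKAssignment k (fun _ : V => colorSet k) :=
  fun _ => card_colorSet k

/-! ### Configurations of two and three edges -/

/-- Two distinct edges have a vertex of the first one outside the second one. -/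
theorem exists_eq_mk_notMem {e f : Sym2 V} (he : ¬ e.IsDiag) (hef : e ≠ f) :
    ∃ x y, e = s(x, y) ∧ x ≠ y ∧ x ∉ f := by
  induction e using Sym2.ind with
  | _ x y =>
    have hxy : x ≠ y := by simpa using he
    by_cases hx : x ∈ f
    · refine ⟨y, x, Sym2.eq_swap, hxy.symm, fun hy => hef ?_⟩
      exact ((Sym2.mem_and_mem_iff hxy).1 ⟨hx, hy⟩).symm
    · exact ⟨x, y, rfl, hxy, hx⟩

/-- Three distinct edges form a triangle, unless one of them has an end on no other. -/
theorem triangle_or_exists_leaf {A : Finset (Sym2 V)} (hA : #A = 3) (hd : ∀ e ∈ A, ¬ e.IsDiag) :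
    (∃ x y z, x ≠ y ∧ y ≠ z ∧ x ≠ z ∧ A = {s(x, y), s(y, z), s(x, z)}) ∨
      ∃ x y, s(x, y) ∈ A ∧ x ≠ y ∧ ∀ f ∈ A.erase s(x, y), x ∉ f := by
  by_contra! h
  obtain ⟨htri, hleaf⟩ := h
  have hleaf' : ∀ e ∈ A, ∀ x ∈ e, ∃ f ∈ A, f ≠ e ∧ x ∈ f := by
    intro e he x hx
    obtain ⟨y, rfl⟩ := hx
    obtain ⟨f, hf, hxf⟩ := hleaf x y he (by simpa using hd _ he)
    rw [mem_erase] at hf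
    exact ⟨f, hf.2, hf.1, hxf⟩
  obtain ⟨e, he⟩ : A.Nonempty := card_pos.1 (by omega)
  induction e using Sym2.ind with
  | _ x y =>
    have hxy : x ≠ y := by simpa using hd _ he
    obtain ⟨f, hf, hfe, z, rfl⟩ := hleaf' _ he x (Sym2.mem_mk_left x y)
    obtain ⟨g, hg, hge, w, rfl⟩ := hleaf' _ he y (Sym2.mem_mk_right x y)
    have hxz : x ≠ z := by simpa using hd _ hf
    have hyw : y ≠ w := by simpa using hd _ hg
    have hfg : s(x, z) ≠ s(y, w) := by
      intro h
      rcases Sym2.eq_iff.1 h with ⟨h1, h2⟩ | ⟨h1, h2⟩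
      · exact hxy h1
      · exact hfe (by rw [h2])
    have hAeq : {s(x, y), s(x, z), s(y, w)} = A := by
      refine eq_of_subset_of_card_le (by simp [insert_subset_iff, he, hf, hg]) ?_
      rw [hA, card_eq_three.2 ⟨_, _, _, hfe.symm, hge.symm, hfg, rfl⟩]
    -- The end `z` must lie on a second edge, and only `s(y, w)` can contain it; so `w = z` and the
    -- triangle closes.
    obtain ⟨h, hh, hhf, hzh⟩ := hleaf' _ hf z (Sym2.mem_mk_right x z)
    have hzy : z ≠ y := by rintro rfl; exact hfe rfl
    rw [← hAeq] at hh
    simp only [mem_insert, mem_singleton] at hh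
    rcases hh with rfl | rfl | rfl
    · simp only [Sym2.mem_iff] at hzh
      exact hzh.elim hxz.symm hzy
    · exact hhf rfl
    · simp only [Sym2.mem_iff] at hzh
      obtain rfl := hzh.resolve_left hzy
      exact htri x y z hxy hyw hxz (by rw [← hAeq]; ext; simp; tauto)

/-! ### Binomial sums -/

/-- The alternating sum of the first binomial coefficients of `n + 1`. -/
theorem one_sub_choose_three (n : ℕ) :
    1 - ((n + 1 : ℕ) : ℤ) + (n + 1).choose 2 - (n + 1).choose 3 = - (n.choose 3 : ℤ) := by
  rw [Nat.choose_succ_succ' n 1, Nat.choose_succ_succ' n 2]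
  push_cast
  rw [Nat.choose_one_right]
  ring

/-- Pointwise Bonferroni inequality, with `n` the number of conflicts of one coloring: for positive
`n` the truncated alternating sum telescopes to a single signed binomial coefficient. -/
theorem bonferroni_three (n : ℕ) :
    (1 : ℤ) - n + n.choose 2 - n.choose 3 ≤ if n = 0 then 1 else 0 := by
  cases n with
  | zero => simp
  | succ n =>
    rw [one_sub_choose_three]
    simp

theorem bonferroni_four (n : ℕ) :
    (if n = 0 then 1 else 0) ≤ (1 : ℤ) - n + n.choose 2 - n.choose 3 + n.choose 4 := by
  cases n with
  | zero => simp
  | succ n =>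
    rw [one_sub_choose_three, Nat.choose_succ_succ' n 3]
    simp

/-- Each element lies in exactly `#E - 1` pairs. -/
theorem sum_powersetCard_two {α : Type*} (E : Finset α) (δ : α → ℤ) :
    ∑ A ∈ E.powersetCard 2, ∑ e ∈ A, δ e = (#E - 1) * ∑ e ∈ E, δ e := by
  induction E using Finset.induction_on with
  | empty => rw [powersetCard_eq_empty.2 (by simp)]; simp
  | insert a E ha ih =>
    have hdisj : Disjoint (E.powersetCard 2) ((E.powersetCard 1).image (insert a)) := by
      rw [disjoint_left]
      intro A hA hA'
      obtain ⟨B, -, rfl⟩ := mem_image.1 hA'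
      exact ha ((mem_powersetCard.1 hA).1 (mem_insert_self a B))
    rw [powersetCard_succ_insert ha, sum_union hdisj, ih, powersetCard_one, sum_insert ha,
      card_insert_of_notMem ha]
    have : ∑ A ∈ (E.map ⟨_, singleton_injective⟩).image (insert a), ∑ e ∈ A, δ e =
        ∑ e ∈ E, (δ a + δ e) := by
      rw [map_eq_image, image_image, sum_image]
      · refine sum_congr rfl fun e he => ?_
        have hne : a ≠ e := fun h => ha (h ▸ he)
        simp [sum_pair hne]
      · intro e he f hf hef
        have hne : e ≠ a := fun h => ha (h ▸ he)
        have : e ∈ ({a, f} : Finset α) := by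
          have h1 : ({a, e} : Finset α) = {a, f} := hef
          rw [← h1]; simp
        simpa [hne] using this
    rw [this, sum_add_distrib, sum_const, nsmul_eq_mul]
    push_cast
    ring

/-! ### Recoloring one vertex -/

variable [Fintype V]

/-- Exchanging `c x` with `a` is an involution on pairs of a coloring and a color from `L x`. This
plays the role of averaging over the color at `x`. -/
theorem card_mul_sum_piFinset (L : V → Finset ℤ) (x : V) (F : (V → ℤ) → ℕ) :
    #(L x) * ∑ c ∈ Fintype.piFinset L, F c =
      ∑ c ∈ Fintype.piFinset L, ∑ a ∈ L x, F (update c x a) := by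
  rw [← sum_product', mul_sum]
  have : ∑ c ∈ Fintype.piFinset L, #(L x) * F c =
      ∑ p ∈ Fintype.piFinset L ×ˢ L x, F p.1 := by
    rw [sum_product]
    simp
  rw [this]
  refine sum_bij' (fun p _ => (update p.1 x p.2, p.1 x)) (fun p _ => (update p.1 x p.2, p.1 x))
    ?_ ?_ ?_ ?_ ?_
  · rintro ⟨c, a⟩ h
    simp only [mem_product, Fintype.mem_piFinset] at h ⊢
    refine ⟨fun v => ?_, h.1 x⟩
    by_cases hv : v = x
    · subst hv; simpa using h.2
    · simpa [hv] using h.1 v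
  · rintro ⟨c, a⟩ h
    simp only [mem_product, Fintype.mem_piFinset] at h ⊢
    refine ⟨fun v => ?_, h.1 x⟩
    by_cases hv : v = x
    · subst hv; simpa using h.2
    · simpa [hv] using h.1 v
  · rintro ⟨c, a⟩ _; simp
  · rintro ⟨c, a⟩ _; simp
  · rintro ⟨c, a⟩ _; simp

/-- Counting colorings whose value at `x` is determined by the values elsewhere. -/
theorem card_mul_card_filter_eq (L : V → Finset ℤ) (x : V) (Q : (V → ℤ) → Prop) [DecidablePred Q] (g : (V → ℤ) → ℤ)
    (hQ : ∀ c a, Q (update c x a) ↔ Q c) (hg : ∀ c a, g (update c x a) = g c) :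
    #(L x) * #{c ∈ Fintype.piFinset L | Q c ∧ c x = g c} =
      #{c ∈ Fintype.piFinset L | Q c ∧ g c ∈ L x} := by
  rw [card_filter, card_filter, card_mul_sum_piFinset]
  refine sum_congr rfl fun c _ => ?_
  simp only [hQ, hg, update_self]
  by_cases h : Q c <;> simp [h]

theorem card_mul_card_filter_le (L : V → Finset ℤ) (x : V) (Q : (V → ℤ) → Prop) [DecidablePred Q] (g : (V → ℤ) → ℤ)
    (hQ : ∀ c a, Q (update c x a) ↔ Q c) (hg : ∀ c a, g (update c x a) = g c) :
    #(L x) * #{c ∈ Fintype.piFinset L | Q c ∧ c x = g c} ≤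
      #{c ∈ Fintype.piFinset L | Q c} := by
  rw [card_mul_card_filter_eq L x Q g hQ hg]
  exact card_le_card (monotone_filter_right _ fun _ _ h => h.1)

theorem card_mul_card_filter_apply (L : V → Finset ℤ) (y : V) (p : ℤ → Prop) [DecidablePred p] :
    #(L y) * #{c ∈ Fintype.piFinset L | p (c y)} =
      #(Fintype.piFinset L) * #{a ∈ L y | p a} := by
  rw [card_filter, card_mul_sum_piFinset]
  simp

/-- The number of colorings from `L` with a conflict at each edge in `A`. -/
noncomputable def conflictCount (S : SignedGraph V) (L : V → Finset ℤ) (A : Finset (Sym2 V)) : ℕ :=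
  #{c ∈ Fintype.piFinset L | ∀ e ∈ A, S.Conflict c e}

theorem conflictCount_anti (S : SignedGraph V) (L : V → Finset ℤ) {A B : Finset (Sym2 V)}
    (h : A ⊆ B) : S.conflictCount L B ≤ S.conflictCount L A :=
  card_le_card (monotone_filter_right _ fun _ _ hc e he => hc e (h he))

theorem conflictCount_empty (S : SignedGraph V) {k : ℕ} {L : V → Finset ℤ}
    (hL : IsKAssignment k L) : S.conflictCount L ∅ = k ^ Fintype.card V := by
  have hL' : ∀ v, #(L v) = k := hL
  simp [conflictCount, Fintype.card_piFinset, hL']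

/-- No edge of `A` meets `x`, so the new conflict just prescribes the color at `x`, and costs a
factor `k` exactly when that color is available. -/
theorem mul_conflictCount_insert (S : SignedGraph V) {k : ℕ} {L : V → Finset ℤ}
    (hL : IsKAssignment k L) {x y : V} {A : Finset (Sym2 V)} (hxy : x ≠ y)
    (hx : ∀ e ∈ A, x ∉ e) :
    k * S.conflictCount L (insert s(x, y) A) =
      #{c ∈ Fintype.piFinset L | (∀ e ∈ A, S.Conflict c e) ∧
        S.totalSign s(x, y) * c y ∈ L x} := by
  rw [← card_mul_card_filter_eq L x (fun c => ∀ e ∈ A, S.Conflict c e)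
    (fun c => S.totalSign s(x, y) * c y), hL x, conflictCount]
  · congr 2
    ext c
    simp only [forall_mem_insert, conflict_mk, mem_filter]
    tauto
  · exact fun c a => forall₂_congr fun e he => S.conflict_update (hx e he) c a
  · intro c a
    rw [update_of_ne hxy.symm]

theorem mul_conflictCount_insert_le (S : SignedGraph V) {k : ℕ} {L : V → Finset ℤ}
    (hL : IsKAssignment k L) {x y : V} {A : Finset (Sym2 V)} (hxy : x ≠ y)
    (hx : ∀ e ∈ A, x ∉ e) :
    k * S.conflictCount L (insert s(x, y) A) ≤ S.conflictCount L A := by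
  rw [S.mul_conflictCount_insert hL hxy hx]
  exact card_le_card (monotone_filter_right _ fun _ _ h => h.1)

/-- `M_k` is closed under negation, so the prescribed color is always available and the general
upper bound is attained. -/
theorem mul_conflictCount_colorSet_insert (S : SignedGraph V) (k : ℕ)
    {x y : V} {A : Finset (Sym2 V)} (hxy : x ≠ y) (hx : ∀ e ∈ A, x ∉ e) :
    k * S.conflictCount (fun _ => colorSet k) (insert s(x, y) A) =
      S.conflictCount (fun _ => colorSet k) A := by
  rw [S.mul_conflictCount_insert (isKAssignment_colorSet k) hxy hx, conflictCount]
  congr 1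
  refine filter_congr fun c hc => ?_
  rw [Fintype.mem_piFinset] at hc
  exact and_iff_left (unit_mul_mem_colorSet _ (hc y))

/-! ### One and two edges -/

theorem mul_conflictCount_singleton (S : SignedGraph V) {k : ℕ} {L : V → Finset ℤ}
    (hL : IsKAssignment k L) {x y : V} (hxy : x ≠ y) :
    k ^ 2 * S.conflictCount L {s(x, y)} =
      k ^ Fintype.card V * #{a ∈ L y | (S.totalSign s(x, y) : ℤ) * a ∈ L x} := by
  rw [← insert_empty_eq, pow_two, mul_assoc, S.mul_conflictCount_insert hL hxy (by simp)]
  have := card_mul_card_filter_apply L y (fun a => (S.totalSign s(x, y) : ℤ) * a ∈ L x)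
  rw [hL y, Fintype.card_piFinset] at this
  have hL' : ∀ v, #(L v) = k := hL
  simpa [hL'] using this

theorem mul_conflictCount_colorSet_singleton (S : SignedGraph V) (k : ℕ) {e : Sym2 V}
    (he : ¬ e.IsDiag) :
    k * S.conflictCount (fun _ => colorSet k) {e} = k ^ Fintype.card V := by
  induction e using Sym2.ind with
  | _ x y =>
    rw [← insert_empty_eq, S.mul_conflictCount_colorSet_insert k (by simpa using he) (by simp),
      conflictCount_empty S (isKAssignment_colorSet k)]

theorem mul_conflictCount_colorSet_pair (S : SignedGraph V) (k : ℕ) {e f : Sym2 V}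
    (he : ¬ e.IsDiag) (hf : ¬ f.IsDiag) (hef : e ≠ f) :
    k ^ 2 * S.conflictCount (fun _ => colorSet k) {e, f} = k ^ Fintype.card V := by
  obtain ⟨x, y, rfl, hxy, hx⟩ := exists_eq_mk_notMem he hef
  rw [pow_two, mul_assoc, S.mul_conflictCount_colorSet_insert k hxy (by simpa using hx),
    S.mul_conflictCount_colorSet_singleton k hf]

theorem mul_conflictCount_singleton_le (S : SignedGraph V) {k : ℕ} {L : V → Finset ℤ}
    (hL : IsKAssignment k L) {e : Sym2 V} (he : ¬ e.IsDiag) :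
    k * S.conflictCount L {e} ≤ k ^ Fintype.card V := by
  induction e using Sym2.ind with
  | _ x y =>
    rw [← insert_empty_eq, ← conflictCount_empty S hL]
    exact S.mul_conflictCount_insert_le hL (by simpa using he) (by simp)

theorem mul_conflictCount_pair_le (S : SignedGraph V) {k : ℕ} {L : V → Finset ℤ}
    (hL : IsKAssignment k L) {e f : Sym2 V}
    (he : ¬ e.IsDiag) (hf : ¬ f.IsDiag) (hef : e ≠ f) :
    k ^ 2 * S.conflictCount L {e, f} ≤ k ^ Fintype.card V := by
  obtain ⟨x, y, rfl, hxy, hx⟩ := exists_eq_mk_notMem he hef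
  rw [pow_two, mul_assoc]
  exact (Nat.mul_le_mul_left _ (S.mul_conflictCount_insert_le hL hxy (by simpa using hx))).trans
    (S.mul_conflictCount_singleton_le hL hf)

/-- In terms of probabilities: `k * (1/k² - P(e ∧ f)) ≤ (1/k - P(e)) + (1/k - P(f))`. A conflict at
`f` extends to `e = xy` unless the color at `y` has no partner in `L x`; among colorings with such a
color at `y`, a conflict at `f` still occurs at most once in `k`. -/
theorem le_mul_conflictCount_pair (S : SignedGraph V) {k : ℕ} {L : V → Finset ℤ}
    (hL : IsKAssignment k L) {e f : Sym2 V}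
    (he : ¬ e.IsDiag) (hf : ¬ f.IsDiag) (hef : e ≠ f) :
    k ^ 2 * S.conflictCount L {e} + k ^ 2 * S.conflictCount L {f} ≤
      k ^ 3 * S.conflictCount L {e, f} + k ^ (Fintype.card V + 1) := by
  obtain ⟨x, y, rfl, hxy, hx⟩ := exists_eq_mk_notMem he hef
  have hpair := S.mul_conflictCount_insert hL (A := {f}) hxy (by simpa using hx)
  have hsingle := S.mul_conflictCount_singleton hL hxy
  simp only [mem_singleton, forall_eq] at hpair
  set p : ℤ → Prop := fun a => S.totalSign s(x, y) * a ∈ L x with hp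
  have hsplit : S.conflictCount L {f} = k * S.conflictCount L {s(x, y), f} +
      #{c ∈ Fintype.piFinset L | S.Conflict c f ∧ ¬ p (c y)} := by
    rw [hpair, conflictCount]
    simp only [mem_singleton, forall_eq]
    rw [← filter_filter, ← filter_filter, card_filter_add_card_filter_not]
  have hle : k * #{c ∈ Fintype.piFinset L | S.Conflict c f ∧ ¬ p (c y)} ≤
      #{c ∈ Fintype.piFinset L | ¬ p (c y)} := by
    -- Recoloring must happen at an end of `f` other than `y`, to leave the condition on `c y`
    -- intact.
    obtain ⟨z, w, rfl, hzw, hzy⟩ : ∃ z w, f = s(z, w) ∧ z ≠ w ∧ z ≠ y := by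
      induction f using Sym2.ind with
      | _ z w =>
        have hzw : z ≠ w := by simpa using hf
        by_cases h : z = y
        · exact ⟨w, z, Sym2.eq_swap, hzw.symm, h ▸ hzw.symm⟩
        · exact ⟨z, w, rfl, hzw, h⟩
    have := card_mul_card_filter_le L z (fun c => ¬ p (c y))
      (fun c => S.totalSign s(z, w) * c w)
      (fun c a => by rw [update_of_ne hzy.symm]) (fun c a => by rw [update_of_ne hzw.symm])
    rw [hL z] at this
    convert this using 4
    rw [conflict_mk, and_comm]
  have hnot : k * #{c ∈ Fintype.piFinset L | ¬ p (c y)} + k ^ 2 * S.conflictCount L {s(x, y)} =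
      k ^ (Fintype.card V + 1) := by
    have h1 := card_mul_card_filter_apply L y (fun a => ¬ p a)
    have h2 := card_filter_add_card_filter_not (s := L y) p
    rw [hL y] at h1 h2
    rw [hsingle, h1, Fintype.card_piFinset]
    have hL' : ∀ v, #(L v) = k := hL
    simp only [hL', prod_const, card_univ]
    rw [pow_succ, ← mul_add, add_comm, h2]
  have := Nat.mul_le_mul_left k hle
  rw [hsplit]
  linarith

/-! ### Three and four edges -/

theorem pow_three_mul_conflictCount_le_of_leaf (S : SignedGraph V) {k : ℕ} {L : V → Finset ℤ}
    (hL : IsKAssignment k L) {x y : V} (hxy : x ≠ y) {e f : Sym2 V}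
    (he : ¬ e.IsDiag) (hf : ¬ f.IsDiag) (hef : e ≠ f) (hxe : x ∉ e) (hxf : x ∉ f) :
    k ^ 3 * S.conflictCount L {s(x, y), e, f} ≤ k ^ Fintype.card V := by
  have h1 := S.mul_conflictCount_insert_le hL (A := {e, f}) hxy (by simp [hxe, hxf])
  have h2 := S.mul_conflictCount_pair_le hL he hf hef
  have h3 := Nat.mul_le_mul_left (k ^ 2) h1
  calc _ = k ^ 2 * (k * S.conflictCount L {s(x, y), e, f}) := by ring
    _ ≤ _ := h3.trans h2

/-- Serves unbalanced triangles, whose three conflicts force the color 0 on all corners. The nested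
conjunction lets `card_mul_card_filter_le` strip one vertex at a time. -/
theorem pow_three_mul_card_filter_zero_le {k : ℕ} {L : V → Finset ℤ}
    (hL : IsKAssignment k L) {x y z : V} (hxy : x ≠ y) (hyz : y ≠ z) (hxz : x ≠ z) :
    k ^ 3 * #{c ∈ Fintype.piFinset L | ((True ∧ c x = 0) ∧ c y = 0) ∧ c z = 0} ≤
      k ^ Fintype.card V := by
  have hL' : ∀ v, #(L v) = k := hL
  have h1 := card_mul_card_filter_le L z (fun c => (True ∧ c x = 0) ∧ c y = 0) (fun _ => 0)
    (fun c a => by rw [update_of_ne hxz, update_of_ne hyz]) (fun _ _ => rfl)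
  have h2 := card_mul_card_filter_le L y (fun c => True ∧ c x = 0) (fun _ => 0)
    (fun c a => by rw [update_of_ne hxy]) (fun _ _ => rfl)
  have h3 := card_mul_card_filter_le L x (fun c => True) (fun _ => 0)
    (fun c a => Iff.rfl) (fun _ _ => rfl)
  simp only [filter_true, Fintype.card_piFinset, hL', prod_const, card_univ] at h1 h2 h3
  have h4 := Nat.mul_le_mul_left k h2
  have h5 := Nat.mul_le_mul_left (k * k) h1
  linarith

/-- Only a balanced triangle can exceed `k ^ (n - 3)` conflicts. There two conflicts imply the
third, so `M_k` already attains the maximal pair count and `L` has no excess. -/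
theorem mul_conflictCount_triple_le (S : SignedGraph V) {k : ℕ} {L : V → Finset ℤ}
    (hL : IsKAssignment k L) {A : Finset (Sym2 V)} (hA : #A = 3) (hd : ∀ e ∈ A, ¬ e.IsDiag) :
    k ^ 3 * S.conflictCount L A ≤
      k ^ 3 * S.conflictCount (fun _ => colorSet k) A + k ^ Fintype.card V := by
  rcases triangle_or_exists_leaf hA hd with ⟨x, y, z, hxy, hyz, hxz, rfl⟩ | ⟨x, y, hxyA, hxy, hx⟩
  · have hne : s(x, y) ≠ s(y, z) := by
      rw [Ne, Sym2.eq_iff]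
      rintro (h | h)
      · exact hxy h.1
      · exact hxz h.1
    have hd1 := hd s(x, y) (by simp)
    have hd2 := hd s(y, z) (by simp)
    by_cases hs : S.totalSign s(x, z) = S.totalSign s(x, y) * S.totalSign s(y, z)
    · have h1 := S.conflictCount_anti L (A := {s(x, y), s(y, z)})
        (B := {s(x, y), s(y, z), s(x, z)}) (by simp [insert_subset_iff])
      have h2 := S.mul_conflictCount_pair_le hL hd1 hd2 hne
      have h3 := S.mul_conflictCount_colorSet_pair k hd1 hd2 hne
      have h4 : S.conflictCount (fun _ => colorSet k) {s(x, y), s(y, z), s(x, z)} =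
          S.conflictCount (fun _ => colorSet k) {s(x, y), s(y, z)} := by
        rw [conflictCount, conflictCount]
        congr 2
        ext c
        simp only [forall_mem_insert, mem_singleton, forall_eq, conflict_mk]
        refine and_congr_right fun hc1 => and_iff_left_of_imp fun hc2 => ?_
        rw [hc1, hc2, hs]
        push_cast
        ring
      have h5 : k ^ 3 * S.conflictCount L {s(x, y), s(y, z), s(x, z)} ≤
          k * (k ^ 2 * S.conflictCount L {s(x, y), s(y, z)}) := by
        rw [pow_succ', mul_assoc]
        gcongr
      have h6 := Nat.mul_le_mul_left k h2
      rw [h4]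
      refine (h5.trans h6).trans ?_
      rw [← h3, ← mul_assoc, ← pow_succ']
      exact Nat.le_add_right _ _
    · refine le_trans ?_ (Nat.le_add_left _ _)
      refine le_trans (Nat.mul_le_mul_left _ ?_)
        (pow_three_mul_card_filter_zero_le hL hxy hyz hxz)
      refine card_le_card (monotone_filter_right _ fun c _ hc => ?_)
      simp only [forall_mem_insert, mem_singleton, forall_eq, conflict_mk] at hc
      obtain ⟨h1, h2, h3⟩ := hc
      rcases Int.units_eq_one_or (S.totalSign s(x, y)) with ha | ha <;>
      rcases Int.units_eq_one_or (S.totalSign s(y, z)) with hb | hb <;>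
      rcases Int.units_eq_one_or (S.totalSign s(x, z)) with hc | hc <;>
      simp [ha, hb, hc] at hs h1 h2 h3 ⊢ <;> omega
  · have hcard : #(A.erase s(x, y)) = 2 := by rw [card_erase_of_mem hxyA, hA]
    obtain ⟨e, f, hef, hB⟩ := card_eq_two.1 hcard
    have hA' : A = {s(x, y), e, f} := by rw [← hB, insert_erase hxyA]
    rw [hB] at hx
    rw [hA'] at hd ⊢
    refine le_trans ?_ (Nat.le_add_left _ _)
    exact S.pow_three_mul_conflictCount_le_of_leaf hL hxy (hd e (by simp)) (hd f (by simp)) hef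
      (hx e (by simp)) (hx f (by simp))

/-- It suffices to find three of the four edges with an end lying on only one of them. If three
edges form a triangle, the fourth has an end outside it, and is taken with two sides of the
triangle. -/
theorem mul_conflictCount_quadruple_le (S : SignedGraph V) {k : ℕ} {L : V → Finset ℤ}
    (hL : IsKAssignment k L) {A : Finset (Sym2 V)} (hA : #A = 4) (hd : ∀ e ∈ A, ¬ e.IsDiag) :
    k ^ 3 * S.conflictCount L A ≤ k ^ Fintype.card V := by
  obtain ⟨h, hh⟩ : A.Nonempty := card_pos.1 (by omega)
  have hcard : #(A.erase h) = 3 := by rw [card_erase_of_mem hh, hA]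
  have hdB : ∀ e ∈ A.erase h, ¬ e.IsDiag := fun e he => hd e (mem_of_mem_erase he)
  rcases triangle_or_exists_leaf hcard hdB with
    ⟨x, y, z, hxy, hyz, hxz, hB⟩ | ⟨x, y, hxyA, hxy, hx⟩
  · have hmem : ∀ e ∈ ({s(x, y), s(y, z), s(x, z)} : Finset (Sym2 V)), e ∈ A ∧ e ≠ h := by
      intro e he
      rw [← hB, mem_erase] at he
      exact ⟨he.2, he.1⟩
    have h1 := hmem s(x, y) (by simp)
    have h2 := hmem s(y, z) (by simp)
    have h3 := hmem s(x, z) (by simp)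
    have hne : s(x, y) ≠ s(y, z) := by
      rw [Ne, Sym2.eq_iff]
      rintro (h | h)
      · exact hxy h.1
      · exact hxz h.1
    obtain ⟨w, u, rfl, hwu, hwe, hwf⟩ :
        ∃ w u, h = s(w, u) ∧ w ≠ u ∧ w ∉ s(x, y) ∧ w ∉ s(y, z) := by
      induction h using Sym2.ind with
      | _ p q =>
        have hpq : p ≠ q := by simpa using hd _ hh
        by_cases hp : p ∉ s(x, y) ∧ p ∉ s(y, z)
        · exact ⟨p, q, rfl, hpq, hp⟩
        · refine ⟨q, p, Sym2.eq_swap, hpq.symm, ?_⟩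
          have e1 := h1.2
          have e2 := h2.2
          have e3 := h3.2
          simp only [Sym2.mem_iff, ne_eq, Sym2.eq_iff] at hp e1 e2 e3 ⊢
          grind
    refine le_trans (Nat.mul_le_mul_left _ ?_) (S.pow_three_mul_conflictCount_le_of_leaf hL hwu
      (hd _ h1.1) (hd _ h2.1) hne hwe hwf)
    exact S.conflictCount_anti L (by simp [insert_subset_iff, h1.1, h2.1, hh])
  · have hcard' : #((A.erase h).erase s(x, y)) = 2 := by rw [card_erase_of_mem hxyA, hcard]
    obtain ⟨e, f, hef, hC⟩ := card_eq_two.1 hcard'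
    rw [hC] at hx
    have hmem : ∀ g ∈ ({e, f} : Finset (Sym2 V)), g ∈ A := by
      intro g hg
      rw [← hC] at hg
      exact mem_of_mem_erase (mem_of_mem_erase hg)
    have he := hmem e (by simp)
    have hf := hmem f (by simp)
    refine le_trans (Nat.mul_le_mul_left _ ?_) (S.pow_three_mul_conflictCount_le_of_leaf hL hxy
      (hd _ he) (hd _ hf) hef (hx e (by simp)) (hx f (by simp)))
    exact S.conflictCount_anti L
      (by simp [insert_subset_iff, he, hf, mem_of_mem_erase hxyA])

/-! ### Bonferroni inequalities -/

/-- Double counting of pairs of a coloring and a `j`-set of edges at which it conflicts. -/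
theorem sum_choose_card_conflict (S : SignedGraph V) (L : V → Finset ℤ) (E : Finset (Sym2 V))
    (j : ℕ) :
    ∑ c ∈ Fintype.piFinset L, ((#{e ∈ E | S.Conflict c e}).choose j : ℤ) =
      ∑ A ∈ E.powersetCard j, (S.conflictCount L A : ℤ) := by
  simp only [conflictCount, card_filter]
  norm_cast
  rw [sum_comm]
  refine sum_congr rfl fun c _ => ?_
  rw [← card_filter, ← card_powersetCard, ← card_filter]
  congr 1
  ext A
  simp only [mem_powersetCard, mem_filter, subset_iff]
  constructor
  · rintro ⟨h1, h2⟩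
    exact ⟨⟨fun e he => (h1 he).1, h2⟩, fun e he => (h1 he).2⟩
  · rintro ⟨⟨h1, h2⟩, h3⟩
    exact ⟨fun e he => ⟨h1 he, h3 e he⟩, h2⟩

theorem numListColorings_eq_sum (S : SignedGraph V) (L : V → Finset ℤ) :
    (S.numListColorings L : ℤ) = ∑ c ∈ Fintype.piFinset L,
      if #{e ∈ S.graph.edgeFinset | S.Conflict c e} = 0 then 1 else 0 := by
  rw [numListColorings, ← natCast_card_filter]
  congr 1
  rw [← Set.ncard_coe_finset]
  congr 1
  ext c
  simp only [isProper_iff, Set.mem_ofPred_eq, coe_filter, Fintype.mem_piFinset, card_eq_zero,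
    filter_eq_empty_iff, SimpleGraph.mem_edgeFinset]
  tauto

/-- The sum of the conflict counts of all sets of `j` edges. -/
noncomputable def conflictSum (S : SignedGraph V) (L : V → Finset ℤ) (j : ℕ) : ℤ :=
  ∑ A ∈ S.graph.edgeFinset.powersetCard j, (S.conflictCount L A : ℤ)

theorem conflictSum_zero (S : SignedGraph V) {k : ℕ} {L : V → Finset ℤ}
    (hL : IsKAssignment k L) : S.conflictSum L 0 = k ^ Fintype.card V := by
  simp [conflictSum, conflictCount_empty S hL]

theorem conflictSum_one (S : SignedGraph V) (L : V → Finset ℤ) :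
    S.conflictSum L 1 = ∑ e ∈ S.graph.edgeFinset, (S.conflictCount L {e} : ℤ) := by
  simp [conflictSum, powersetCard_one]

theorem le_numListColorings (S : SignedGraph V) (L : V → Finset ℤ) :
    S.conflictSum L 0 - S.conflictSum L 1 + S.conflictSum L 2 - S.conflictSum L 3 ≤
      S.numListColorings L := by
  simp only [conflictSum, ← sum_choose_card_conflict]
  rw [numListColorings_eq_sum, ← sum_sub_distrib, ← sum_add_distrib, ← sum_sub_distrib]
  refine sum_le_sum fun c _ => ?_
  simpa only [Nat.choose_zero_right, Nat.choose_one_right, Nat.cast_one] using bonferroni_three _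

theorem numListColorings_le (S : SignedGraph V) (L : V → Finset ℤ) :
    (S.numListColorings L : ℤ) ≤ S.conflictSum L 0 - S.conflictSum L 1 + S.conflictSum L 2 -
      S.conflictSum L 3 + S.conflictSum L 4 := by
  simp only [conflictSum, ← sum_choose_card_conflict]
  rw [numListColorings_eq_sum, ← sum_sub_distrib, ← sum_add_distrib, ← sum_sub_distrib,
    ← sum_add_distrib]
  refine sum_le_sum fun c _ => ?_
  simpa only [Nat.choose_zero_right, Nat.choose_one_right, Nat.cast_one] using bonferroni_four _

/-! ### Strict inequality for lists that disagree -/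

theorem numEdges_eq_card (S : SignedGraph V) : S.numEdges = #S.graph.edgeFinset := by
  rw [numEdges, ← SimpleGraph.coe_edgeFinset, Set.ncard_coe_finset]

/-- Lists that disagree along an edge lead to more colorings than the standard color sets. -/
theorem chromaticFunction_lt_numListColorings (S : SignedGraph V) {k : ℕ}
    (hk : ((S.numEdges.choose 3 : ℕ) : ℤ) + ((S.numEdges.choose 4 : ℕ) : ℤ)
      + (S.numEdges : ℤ) - 1 < (k : ℤ)) {L : V → Finset ℤ} (hL : IsKAssignment k L)
    {u v : V} (huv : S.graph.Adj u v)
    (hbad : ¬ ∀ a ∈ L v, (S.totalSign s(u, v) : ℤ) * a ∈ L u) :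
    S.chromaticFunction k < S.numListColorings L := by
  have hk0 : 0 < k := by
    rw [← hL v, card_pos]
    by_contra h
    rw [not_nonempty_iff_eq_empty] at h
    simp [h] at hbad
  set M : V → Finset ℤ := fun _ => colorSet k with hMdef
  have hM : IsKAssignment k M := isKAssignment_colorSet k
  set E := S.graph.edgeFinset with hE
  have hd : ∀ e ∈ E, ¬ e.IsDiag := fun e he =>
    S.graph.not_isDiag_of_mem_edgeSet (SimpleGraph.mem_edgeFinset.1 he)
  have hdA : ∀ {j}, ∀ A ∈ E.powersetCard j, ∀ e ∈ A, ¬ e.IsDiag := fun A hA e he =>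
    hd e ((mem_powersetCard.1 hA).1 he)
  rw [numEdges_eq_card, ← hE] at hk
  set N : ℤ := (k : ℤ) ^ Fintype.card V with hN
  have hNpos : 0 < N := by positivity
  -- The deficit of conflicts at `e` relative to `M_k`, scaled by `k ^ 2` to stay in the integers.
  set δ : Sym2 V → ℤ := fun e => k * N - k ^ 2 * S.conflictCount L {e} with hδ
  have hδ0 : ∀ e ∈ E, 0 ≤ δ e := by
    intro e he
    have h := S.mul_conflictCount_singleton_le hL (hd e he)
    have h' := Nat.mul_le_mul_left k h
    zify at h'
    simp only [hδ, hN]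
    linarith
  have huvE : s(u, v) ∈ E := SimpleGraph.mem_edgeFinset.2 huv
  -- At least one of the `k` colors at `v` has no partner at `u`, and each such color contributes
  -- `N` to the deficit.
  have hδbad : N ≤ δ s(u, v) := by
    have h := S.mul_conflictCount_singleton hL huv.ne
    have hlt : #{a ∈ L v | (S.totalSign s(u, v) : ℤ) * a ∈ L u} + 1 ≤ k := by
      rw [← hL v]
      refine card_lt_card (filter_ssubset.2 ?_)
      push Not at hbad
      exact hbad
    zify at h hlt
    simp only [hδ, h, ← hN]
    nlinarith
  have hΔ : N ≤ ∑ e ∈ E, δ e := hδbad.trans (single_le_sum hδ0 huvE)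
  have h1 : (k : ℤ) ^ 3 * (S.conflictSum M 1 - S.conflictSum L 1) = k * ∑ e ∈ E, δ e := by
    rw [conflictSum_one, conflictSum_one, ← sum_sub_distrib, mul_sum, mul_sum]
    refine sum_congr rfl fun e he => ?_
    have h := S.mul_conflictCount_colorSet_singleton k (hd e he)
    zify at h
    simp only [hδ, hN, ← h]
    ring
  have h2 : (k : ℤ) ^ 3 * (S.conflictSum M 2 - S.conflictSum L 2) ≤ (#E - 1) * ∑ e ∈ E, δ e := by
    rw [← sum_powersetCard_two, conflictSum, conflictSum, ← sum_sub_distrib, mul_sum]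
    refine sum_le_sum fun A hA => ?_
    obtain ⟨e, f, hef, rfl⟩ := card_eq_two.1 (mem_powersetCard.1 hA).2
    have he := hdA _ hA e (by simp)
    have hf := hdA _ hA f (by simp)
    have h := S.mul_conflictCount_colorSet_pair k he hf hef
    have h' := S.le_mul_conflictCount_pair hL he hf hef
    zify at h h'
    rw [sum_pair hef]
    simp only [hδ, hN, ← h]
    rw [pow_succ (k : ℤ) (Fintype.card V), ← h] at h'
    linarith
  have h3 : (k : ℤ) ^ 3 * (S.conflictSum L 3 - S.conflictSum M 3) ≤ (#E).choose 3 * N := by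
    rw [conflictSum, conflictSum, ← sum_sub_distrib, mul_sum, ← card_powersetCard,
      ← nsmul_eq_mul]
    refine sum_le_card_nsmul _ _ _ fun A hA => ?_
    have h := S.mul_conflictCount_triple_le hL (mem_powersetCard.1 hA).2 (hdA A hA)
    zify at h
    linarith
  have h4 : (k : ℤ) ^ 3 * S.conflictSum M 4 ≤ (#E).choose 4 * N := by
    rw [conflictSum, mul_sum, ← card_powersetCard, ← nsmul_eq_mul]
    refine sum_le_card_nsmul _ _ _ fun A hA => ?_
    have h := S.mul_conflictCount_quadruple_le hM (mem_powersetCard.1 hA).2 (hdA A hA)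
    zify at h
    exact h
  have hlow := S.le_numListColorings L
  have hup := S.numListColorings_le M
  have h0 : S.conflictSum L 0 = S.conflictSum M 0 := by
    rw [S.conflictSum_zero hL, S.conflictSum_zero hM]
  have hdiff : (S.conflictSum M 1 - S.conflictSum L 1) - (S.conflictSum M 2 - S.conflictSum L 2) -
      (S.conflictSum L 3 - S.conflictSum M 3) - S.conflictSum M 4 ≤
      S.numListColorings L - S.numListColorings M := by
    linarith
  have hk3 : (0 : ℤ) < (k : ℤ) ^ 3 := by positivity
  have hmul := mul_le_mul_of_nonneg_left hdiff hk3.le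
  -- Replacing `∑ δ` by `N` needs `k - m + 1 ≥ 0`, which the bound on `k` gives.
  have hΔ' : ((k : ℤ) - #E + 1) * N ≤ (k - #E + 1) * ∑ e ∈ E, δ e :=
    mul_le_mul_of_nonneg_left hΔ (by
      have := Int.natCast_nonneg ((#E).choose 3)
      have := Int.natCast_nonneg ((#E).choose 4)
      linarith)
  have hfin : 0 < ((k : ℤ) - #E + 1 - (#E).choose 3 - (#E).choose 4) * N :=
    mul_pos (by linarith) hNpos
  have hpos : 0 < (k : ℤ) ^ 3 * (S.numListColorings L - S.numListColorings M) := by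
    linarith
  have := pos_of_mul_pos_right hpos hk3.le
  change S.numListColorings M < _
  omega

end Counting

/-! ### Lists that agree along edges -/

section Agreement

open Finset

variable {V : Type*}

/-- The product of the signs of the edges of a walk. -/
noncomputable def walkSign (S : SignedGraph V) {u v : V} (p : S.graph.Walk u v) : ℤˣ :=
  (p.edges.map S.totalSign).prod

/-- A cycle repeats no edge, so the set of its negative edges counts the factors `-1` correctly. -/
theorem walkSign_eq_neg_one (S : SignedGraph V) {u : V} {p : S.graph.Walk u u}
    (hp : S.IsUnbalancedCycle p) : S.walkSign p = -1 := by
  classical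
  have key : ∀ l : List (Sym2 V), l.Nodup → (∀ e ∈ l, e ∈ S.graph.edgeSet) →
      (l.map S.totalSign).prod = (-1) ^ {e : Sym2 V | e ∈ l ∧ S.IsNegative e}.ncard := by
    intro l
    induction l with
    | nil => simp
    | cons e l ih =>
      intro hnd hmem
      rw [List.nodup_cons] at hnd
      rw [List.forall_mem_cons] at hmem
      have hfin : {e : Sym2 V | e ∈ l ∧ S.IsNegative e}.Finite :=
        l.toFinset.finite_toSet.subset fun f hf => by simpa using hf.1
      rw [List.map_cons, List.prod_cons, ih hnd.2 hmem.2]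
      by_cases he : S.IsNegative e
      · have hset : {f : Sym2 V | f ∈ e :: l ∧ S.IsNegative f} =
            insert e {f : Sym2 V | f ∈ l ∧ S.IsNegative f} := by
          ext f
          simp only [List.mem_cons, Set.mem_ofPred_eq, Set.mem_insert_iff]
          constructor
          · tauto
          · rintro (rfl | h)
            · exact ⟨Or.inl rfl, he⟩
            · exact ⟨Or.inr h.1, h.2⟩
        obtain ⟨h, hs⟩ := he
        rw [hset, Set.ncard_insert_of_notMem (fun h => hnd.1 h.1) hfin, totalSign, dif_pos h, hs,
          pow_succ']
      · have hset : {f : Sym2 V | f ∈ e :: l ∧ S.IsNegative f} =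
            {f : Sym2 V | f ∈ l ∧ S.IsNegative f} := by
          ext f
          simp only [List.mem_cons, Set.mem_ofPred_eq]
          constructor
          · rintro ⟨rfl | h, h'⟩
            · exact absurd h' he
            · exact ⟨h, h'⟩
          · tauto
        have hs : S.totalSign e = 1 := by
          rw [totalSign, dif_pos hmem.1]
          exact (Int.units_eq_one_or _).resolve_right fun h => he ⟨hmem.1, h⟩
        rw [hset, hs, one_mul]
  rw [walkSign, key p.edges hp.1.edges_nodup fun e he => p.edges_subset_edgeSet he,
    hp.2.neg_one_pow]

/-- The lists of adjacent vertices correspond to each other under the sign of the edge. -/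
def ListsAgree (S : SignedGraph V) (L : V → Finset ℤ) : Prop :=
  ∀ u v, S.graph.Adj u v → ∀ a ∈ L v, (S.totalSign s(u, v) : ℤ) * a ∈ L u

theorem ListsAgree.walkSign_mul_mem {S : SignedGraph V} {L : V → Finset ℤ} (h : S.ListsAgree L)
    {u v : V} (p : S.graph.Walk u v) {a : ℤ} (ha : a ∈ L v) : (S.walkSign p : ℤ) * a ∈ L u := by
  induction p with
  | nil => simpa [walkSign] using ha
  | cons huv p ih =>
    have := h _ _ huv _ (ih ha)
    simpa [walkSign, mul_assoc] using this

theorem walkSign_append (S : SignedGraph V) {u v w : V} (p : S.graph.Walk u v)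
    (q : S.graph.Walk v w) : S.walkSign (p.append q) = S.walkSign p * S.walkSign q := by
  simp [walkSign]

theorem walkSign_reverse (S : SignedGraph V) {u v : V} (p : S.graph.Walk u v) :
    S.walkSign p.reverse = S.walkSign p := by
  simp [walkSign, List.prod_reverse]

/-- Walk along `q`, once around `p`, and back along `q`: the sign of `q` enters twice and cancels,
leaving `-1`. -/
theorem ListsAgree.neg_mem {S : SignedGraph V} {L : V → Finset ℤ} (h : S.ListsAgree L)
    {u v : V} {p : S.graph.Walk u u} (hp : S.walkSign p = -1) (q : S.graph.Walk v u)
    {a : ℤ} (ha : a ∈ L v) : -a ∈ L v := by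
  have := h.walkSign_mul_mem ((q.append p).append q.reverse) ha
  rwa [walkSign_append, walkSign_append, walkSign_reverse, hp, mul_right_comm, ← pow_two,
    Int.units_sq, one_mul, Units.val_neg, Units.val_one, neg_one_mul] at this

/-- A symmetric set of integers consists of pairs of opposite numbers, and possibly zero. -/
theorem card_eq_of_neg_mem {T : Finset ℤ} (hT : ∀ a ∈ T, -a ∈ T) :
    #T = 2 * #{a ∈ T | 0 < a} + if (0 : ℤ) ∈ T then 1 else 0 := by
  have hneg : #{a ∈ T | a < 0} = #{a ∈ T | 0 < a} := by
    refine card_nbij' (fun a => -a) (fun a => -a) ?_ ?_ ?_ ?_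
    · intro a ha
      simp only [coe_filter, Set.mem_ofPred_eq] at ha ⊢
      exact ⟨hT a ha.1, by omega⟩
    · intro a ha
      simp only [coe_filter, Set.mem_ofPred_eq] at ha ⊢
      exact ⟨hT a ha.1, by omega⟩
    · intro a _; simp
    · intro a _; simp
  have hzero : #{a ∈ T | a = 0} = if (0 : ℤ) ∈ T then 1 else 0 := by
    rw [filter_eq']
    split_ifs <;> simp
  have h1 := card_filter_add_card_filter_not (s := T) (fun a => 0 < a)
  have h2 := card_filter_add_card_filter_not (s := {a ∈ T | ¬ 0 < a}) (fun a => a < 0)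
  rw [filter_filter, filter_filter] at h2
  have h3 : #{a ∈ T | ¬ 0 < a ∧ a < 0} = #{a ∈ T | a < 0} := by
    congr 1; ext a; simp; omega
  have h4 : #{a ∈ T | ¬ 0 < a ∧ ¬ a < 0} = #{a ∈ T | a = 0} := by
    congr 1; ext a; simp; omega
  omega

theorem exists_mapsTo_injOn_of_card_eq {s t : Finset ℤ} (h : #s = #t) :
    ∃ f : ℤ → ℤ, Set.MapsTo f s t ∧ Set.InjOn f s := by
  obtain ⟨f, hf⟩ := s.finite_toSet.exists_bijOn_of_encard_eq (t := (t : Set ℤ)) (by simp [h])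
  exact ⟨f, hf.mapsTo, hf.injOn⟩

theorem neg_mem_colorSet {k : ℕ} {a : ℤ} (ha : a ∈ colorSet k) : -a ∈ colorSet k := by
  simpa using unit_mul_mem_colorSet (-1) ha

/-- The standard color set embeds into each list of the same size, by an odd map if the list is
symmetric. -/
theorem exists_colorSet_embedding {k : ℕ} {T : Finset ℤ} (hT : #T = k) :
    ∃ f : ℤ → ℤ, Set.MapsTo f (colorSet k) T ∧ Set.InjOn f (colorSet k) ∧
      ((∀ a ∈ T, -a ∈ T) → ∀ a, f (-a) = -f a) := by
  by_cases hsymm : ∀ a ∈ T, -a ∈ T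
  · have h1 := card_eq_of_neg_mem hsymm
    have h2 := card_eq_of_neg_mem (T := colorSet k) fun a => neg_mem_colorSet
    rw [card_colorSet] at h2
    -- Zero in `M_k` makes `k` odd, and a symmetric set of odd size contains zero.
    have hzero : (0 : ℤ) ∈ colorSet k → (0 : ℤ) ∈ T := by
      intro h
      by_contra h'
      rw [if_pos h] at h2
      rw [if_neg h'] at h1
      omega
    have hcard : #{a ∈ colorSet k | 0 < a} = #{a ∈ T | 0 < a} := by
      split_ifs at h1 h2 <;> omega
    obtain ⟨g, hg, hginj⟩ := exists_mapsTo_injOn_of_card_eq hcard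
    have hg' : ∀ a ∈ colorSet k, 0 < a → g a ∈ T ∧ 0 < g a := by
      intro a ha hpos
      simpa using hg (x := a) (by simp [ha, hpos])
    have hginj' : ∀ a ∈ colorSet k, 0 < a → ∀ b ∈ colorSet k, 0 < b → g a = g b → a = b := by
      intro a ha hpos b hb hpos' hab
      exact hginj (by simp [ha, hpos]) (by simp [hb, hpos']) hab
    -- The odd extension of an injection `g` between the positive parts, with 0 sent to 0.
    refine ⟨fun a => if 0 < a then g a else if a < 0 then -g (-a) else 0, ?_, ?_, ?_⟩
    · intro a ha
      rw [mem_coe] at ha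
      rcases lt_trichotomy a 0 with h | rfl | h
      · have := hg' (-a) (neg_mem_colorSet ha) (by omega)
        simpa [h, h.not_gt] using hsymm _ this.1
      · simpa using hzero ha
      · simpa [h] using (hg' a ha h).1
    · intro a ha b hb hab
      rw [mem_coe] at ha hb
      have ha' := neg_mem_colorSet ha
      have hb' := neg_mem_colorSet hb
      have ha₁ := fun h => (hg' a ha h).2
      have ha₂ := fun h => (hg' _ ha' h).2
      have hb₁ := fun h => (hg' b hb h).2
      have hb₂ := fun h => (hg' _ hb' h).2
      have hpos := fun h h' => hginj' a ha h b hb h'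
      have hneg := fun h h' => hginj' _ ha' h _ hb' h'
      dsimp only at hab
      split_ifs at hab <;> grind
    · intro _ a
      rcases lt_trichotomy a 0 with h | rfl | h
      · simp [h, h.not_gt]
      · simp
      · simp [h, h.not_gt]
  · obtain ⟨f, hf, hinj⟩ := exists_mapsTo_injOn_of_card_eq (s := colorSet k) (t := T)
      (by rw [card_colorSet, hT])
    exact ⟨f, hf, hinj, fun h => absurd h hsymm⟩

/-- If the lists agree along the edges, they allow at least as many colorings as the standard color
sets. -/
theorem ListsAgree.chromaticFunction_le [Finite V] {S : SignedGraph V} {k : ℕ} {L : V → Finset ℤ}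
    (h : S.ListsAgree L) (hL : IsKAssignment k L) :
    S.chromaticFunction k ≤ S.numListColorings L := by
  let root : V → V := fun v => (S.graph.connectedComponentMk v).out
  have hroot : ∀ v, S.graph.Reachable v (root v) := fun v =>
    (SimpleGraph.ConnectedComponent.exact (Quot.out_eq (S.graph.connectedComponentMk v))).symm
  let p : ∀ v, S.graph.Walk v (root v) := fun v => (hroot v).some
  choose φ hmaps hinj hodd using fun v => exists_colorSet_embedding (hL v)
  -- Carry the color to the root of the component, embed it into the root's list, and carry it back.
  let ψ : V → ℤ → ℤ := fun v a => S.walkSign (p v) * φ (root v) (S.walkSign (p v) * a)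
  have hψmem : ∀ v, ∀ a ∈ colorSet k, ψ v a ∈ L v := fun v a ha =>
    h.walkSign_mul_mem (p v) (hmaps (root v) (unit_mul_mem_colorSet _ ha))
  have hψinj : ∀ v, ∀ a ∈ colorSet k, ∀ b ∈ colorSet k, ψ v a = ψ v b → a = b := by
    intro v a ha b hb hab
    have h1 := mul_left_cancel₀ (Units.ne_zero _) hab
    have h2 := hinj (root v) (unit_mul_mem_colorSet _ ha) (unit_mul_mem_colorSet _ hb) h1
    exact mul_left_cancel₀ (Units.ne_zero _) h2
  have hψedge : ∀ u v, S.graph.Adj u v → ∀ a,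
      ψ u (S.totalSign s(u, v) * a) = S.totalSign s(u, v) * ψ v a := by
    intro u v huv a
    have hr : root u = root v := by
      simp only [root, SimpleGraph.ConnectedComponent.eq.2 huv.reachable]
    obtain ⟨q, hq⟩ : ∃ q : S.graph.Walk v (root u), S.walkSign q = S.walkSign (p v) := by
      rw [hr]; exact ⟨p v, rfl⟩
    have hcycle : S.walkSign ((p u).reverse.append (.cons huv q)) =
        S.walkSign (p u) * (S.totalSign s(u, v) * S.walkSign (p v)) := by
      rw [walkSign_append, walkSign_reverse, ← hq]
      simp [walkSign]
    -- If the closed walk through `uv` and the root has sign 1, the transports commute with the edge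
    -- sign outright. If it has sign -1, the root's list is symmetric, and oddness of `φ` absorbs
    -- the sign.
    have hodd' : S.walkSign ((p u).reverse.append (.cons huv q)) = -1 →
        ∀ b, φ (root u) (-b) = -φ (root u) b := fun hneg =>
      hodd (root u) fun b hb => h.neg_mem hneg .nil hb
    rw [hcycle] at hodd'
    simp only [ψ, ← hr]
    rcases Int.units_eq_one_or (S.totalSign s(u, v)) with hs | hs <;>
    rcases Int.units_eq_one_or (S.walkSign (p u)) with hu | hu <;>
    rcases Int.units_eq_one_or (S.walkSign (p v)) with hv | hv <;>
    simp [hs, hu, hv] at hodd' ⊢ <;> simp [hodd']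
  refine Set.ncard_le_ncard_of_injOn (fun c v => ψ v (c v)) ?_ ?_ ?_
  · rintro c ⟨hc, hcM⟩
    refine ⟨fun u v huv heq => hc u v huv ?_, fun v => hψmem v _ (hcM v)⟩
    rw [edgeSign_eq_totalSign] at heq ⊢
    rw [← hψedge u v huv] at heq
    exact hψinj u _ (hcM u) _ (unit_mul_mem_colorSet _ (hcM v)) heq
  · rintro c ⟨-, hc⟩ c' ⟨-, hc'⟩ heq
    funext v
    exact hψinj v _ (hc v) _ (hc' v) (congrFun heq v)
  · exact (Set.Finite.pi fun v => (L v).finite_toSet).subset fun c hc v _ => hc.2 v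

end Agreement

end SignedGraph

theorem theorem1p1 {V : Type*} [Finite V] (S : SignedGraph V) (k : ℕ) (hk0 : 0 < k)
    (hk : ((S.numEdges.choose 3 : ℕ) : ℤ) + ((S.numEdges.choose 4 : ℕ) : ℤ)
      + (S.numEdges : ℤ) - 1 < (k : ℤ)) :
    S.listColoringFunction k = S.chromaticFunction k ∧
    ∀ L : V → Finset ℤ, SignedGraph.IsKAssignment k L →
      S.numListColorings L = S.chromaticFunction k →
      (∀ (u v : V) (h : S.graph.Adj u v),
        L u = (L v).image (fun a => S.edgeSign h * a)) ∧
      (∀ C : S.graph.ConnectedComponent, S.IsUnbalancedComponent C →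
        ∀ v ∈ C.supp, L v = (L v).image (fun a => -a)) := by
  have := Fintype.ofFinite V
  have hlt : ∀ L : V → Finset ℤ, SignedGraph.IsKAssignment k L → ¬ S.ListsAgree L →
      S.chromaticFunction k < S.numListColorings L := by
    intro L hL h
    simp only [SignedGraph.ListsAgree, not_forall] at h
    obtain ⟨u, v, huv, a, ha, hbad⟩ := h
    exact S.chromaticFunction_lt_numListColorings hk hL huv fun h => hbad (h a ha)
  refine ⟨le_antisymm ?_ ?_, ?_⟩
  · exact (S.isLeast_listColoringFunction k).2
      ⟨_, SignedGraph.isKAssignment_colorSet k, rfl⟩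
  · obtain ⟨L, hL, hN⟩ := (S.isLeast_listColoringFunction k).1
    rw [← hN]
    by_cases h : S.ListsAgree L
    · exact h.chromaticFunction_le hL
    · exact (hlt L hL h).le
  · intro L hL hN
    have h : S.ListsAgree L := by
      by_contra h
      exact (hlt L hL h).ne' hN
    constructor
    · intro u v huv
      ext a
      rw [Finset.mem_image, SignedGraph.edgeSign_eq_totalSign]
      constructor
      · intro ha
        refine ⟨S.totalSign s(u, v) * a, ?_, SignedGraph.unit_mul_unit_mul _ a⟩
        rw [Sym2.eq_swap]
        exact h v u huv.symm a ha
      · rintro ⟨b, hb, rfl⟩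
        exact h u v huv b hb
    · rintro C ⟨u, p, hu, hp⟩ v hv
      obtain ⟨q⟩ := SimpleGraph.ConnectedComponent.exact
        ((SimpleGraph.ConnectedComponent.mem_supp_iff C v).1 hv |>.trans
          ((SimpleGraph.ConnectedComponent.mem_supp_iff C u).1 hu).symm)
      have hneg : ∀ a ∈ L v, -a ∈ L v := fun a ha =>
        h.neg_mem (S.walkSign_eq_neg_one hp) q ha
      ext a
      rw [Finset.mem_image]
      constructor
      · exact fun ha => ⟨-a, hneg a ha, neg_neg a⟩
      · rintro ⟨b, hb, rfl⟩
        exact hneg b hb
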